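/- Let $f(x)=\frac{\sin x}{x}$ (with $f(0)=1$), let $n\ge 2$, $d>0$, $\sigma>0$, and let $\mu^*=\sum_{j=1}^n a_j^*\delta_{y_j^*}$ be a discrete measure with $n$ distinct locations $y_j^*\in[-d,d]$ and nonzero real amplitudes $a_j^*$. Put $m_{\min}^*=\min_j|a_j^*|$, $m^*=\sum_j|a_j^*|$, and let $M\ge m^*$. Let $R>0$, $0<h\le\pi$, and let $x_1=-R,\ x_2=-R+h,\ \dots,\ x_N=R$ be evenly spaced sample points. Let $\mathbf Y=(\mathbf Y(x_1),\dots,\mathbf Y(x_N))^T$ with $$\mathbf Y(x_t)=\sum_{j=1}^n a_j^*f(x_t-y_j^*)+\mathbf W(x_t),\qquad \mathbf W(x)=\frac1{2\pi}\int_{-\infty}^{\infty}w(\omega)e^{i\omega x}\,d\omega,$$ where $w\in L^2(\mathbb R)$, $w(\omega)=0$ for $|\omega|>1$, and $\|w\|_2\le\sqrt{2\pi}\,\sigma$. A discrete measure $\mu=\sum_{j=1}^k a_j\delta_{y_j}$ with real amplitudes is called $(d,\sigma,M)$-admissible for $\mathbf Y$ if it is supported in $[-d,d]$, $\sum_j|a_j|\le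 M$, and $$\sqrt h\,\Big(\sum_{t=1}^N\big|(\mu*f)(x_t)-\mathbf Y(x_t)\big|^2\Big)^{1/2}\le\sigma,\qquad (\mu*f)(x)=\sum_{j=1}^k a_jf(x-y_j).$$ For $s\ge1$ let $\mathbf H(s)$ be the $N\times s$ matrix whose columns are $\mathbf h_r=\sqrt{2r+1}\,(f^{(r)}(x_1),\dots,f^{(r)}(x_N))^T$, $r=0,\dots,s-1$, and let $\sigma_{\min}(s)$ be the smallest of the $s$ singular values of $\sqrt h\,\mathbf H(s)$, that is, the square root of the smallest eigenvalue of $h\,\mathbf H(s)^T\mathbf H(s)$. Let $s^*$ be the least integer $l\ge1$ such that $$\frac{d^l}{l!\sqrt{2l+1}}\le\frac{\sigma}{2e^d\sqrt\pi\,M}.$$ Assume that $\sigma_{\min}(s^*)>0$ and $$\min_{i\ne j}|y_i^*-y_j^*|\ \ge\ 4.7\,(1+d)\left(\frac{3}{\sigma_{\min}(s^*)}\,\frac{\sigma}{m_{\min}^*}\right)^{\frac1{2n-2}}.$$ Then no discrete measure with fewer than $n$ supports is $(d,\sigma,M)$-admissible for $\mathbf Y$. -/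

import Mathlib

noncomputable section

namespace Deconvolution

/-- A discrete measure `∑ a_j δ_{y_j}` on the real line with real amplitudes, encoded by the finitely
supported function `y ↦ μ({y})`.  Thus `μ.support` is the set of the (distinct) locations `y_j`, all
amplitudes on it are nonzero, and `μ.support.card` is the number of supports of `μ`. -/
abbrev DiscreteMeasure : Type := ℝ →₀ ℝ

/-- The total variation norm `∑ |a_j|`. -/
def tvNorm (μ : DiscreteMeasure) : ℝ := ∑ y ∈ μ.support, |μ y|

/-- The smallest amplitude `min |a_j|` (a minimum over a finite set, nonempty when `μ ≠ 0`). -/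
def minAmplitude (μ : DiscreteMeasure) : ℝ := ⨅ y : μ.support, |μ y|

/-- The point spread function `f(x) = sin x / x`, with `f(0) = 1`. -/
def psf : ℝ → ℝ := Real.sinc

/-- The noiseless image `(μ * f)(x) = ∑ a_j f(x - y_j)`. -/
def image (μ : DiscreteMeasure) (x : ℝ) : ℝ := ∑ y ∈ μ.support, μ y * psf (x - y)

/-- The sample points `-R, -R + h, -R + 2h, …`, indexed from `0`. -/
def samplePoint (R h : ℝ) {N : ℕ} (t : Fin N) : ℝ := -R + (t : ℕ) * h

/-- The band-limited noise `W(x) = (1/2π) ∫ w(ω) e^{iωx} dω` with spectrum `w`. -/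
def noise (w : ℝ → ℂ) (x : ℝ) : ℂ :=
  (1 / (2 * Real.pi) : ℂ) * ∫ ω : ℝ, w ω * Complex.exp (Complex.I * ω * x)

/-- `w` is an `L²` spectrum that vanishes outside `[-1, 1]` and satisfies
`(∫ |w|²)^{1/2} ≤ √(2π) σ`. -/
structure IsNoiseSpectrum (w : ℝ → ℂ) (σ : ℝ) : Prop where
  memLp : MeasureTheory.MemLp w 2
  bandLimited : ∀ ω : ℝ, 1 < |ω| → w ω = 0
  level : √(∫ ω : ℝ, ‖w ω‖ ^ 2) ≤ √(2 * Real.pi) * σ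

/-- The vector of measurements `Y(x_t) = (μ * f)(x_t) + W(x_t)`. -/
def measurement (μ : DiscreteMeasure) (w : ℝ → ℂ) (R h : ℝ) (N : ℕ) (t : Fin N) : ℂ :=
  (image μ (samplePoint R h t) : ℂ) + noise w (samplePoint R h t)

/-- `(d, σ, M)`-admissibility of a discrete measure for the sampled image `Y`. -/
structure IsAdmissible (d σ M R h : ℝ) {N : ℕ} (Y : Fin N → ℂ) (μ : DiscreteMeasure) : Prop where
  supported : ∀ y ∈ μ.support, y ∈ Set.Icc (-d) d
  tvNorm_le : tvNorm μ ≤ M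
  close : √h * √(∑ t : Fin N, ‖(image μ (samplePoint R h t) : ℂ) - Y t‖ ^ 2) ≤ σ

/-- The `N × s` multipole matrix `H(s) = (h_0, …, h_{s-1})` with the columns
`h_r = √(2r+1) (f^{(r)}(x_t))_t`. -/
def multipoleMatrix (R h : ℝ) (N s : ℕ) : Matrix (Fin N) (Fin s) ℝ :=
  Matrix.of fun t r => √(2 * (r : ℕ) + 1) * iteratedDeriv (r : ℕ) psf (samplePoint R h t)

/-- `σ_min(s)`, the smallest of the `s` singular values of `√h H(s)`, i.e. the square root of the
smallest eigenvalue of `h H(s)ᵀ H(s)`.  Mathlib lists the singular values in decreasing order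
starting from index `0`, so for `s ≥ 1` the smallest one has index `s - 1`. -/
def sigmaMin (R h : ℝ) (N s : ℕ) : ℝ :=
  (Matrix.toEuclideanLin (√h • multipoleMatrix R h N s)).singularValues (s - 1)

/-- `s* = min {l ≥ 1 : d^l / (l! √(2l+1)) ≤ σ / (2 e^d √π M)}`. -/
def sStar (d σ M : ℝ) : ℕ :=
  sInf {l : ℕ | 1 ≤ l ∧
    d ^ l / ((l.factorial : ℝ) * √(2 * (l : ℝ) + 1)) ≤
      σ / (2 * Real.exp d * √Real.pi * M)}

end Deconvolution

end

/-! ### Band-limited functions: sampling and multipole expansion. -/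

noncomputable section

namespace Deconvolution

open MeasureTheory

/-! Write n = p + 1 and suppose that `μ` has at most p supports and is admissible. The images, the
noise and the derivatives of the point spread function are all inverse Fourier transforms of spectra
on [-1, 1], so `mul_sum_sq_norm_noise_le` controls their sampled norms by L² norms of spectra.
Taylor expansion of the spectrum of `μ - μs` at frequency 0 gives a multipole sum of order s* whose
coefficients are the moments; by the choice of s* the remainder has norm at most σ
(`mul_sum_sq_image_sub_multipole_le`). Admissibility and noise cost σ each, so the multipole sum has
norm at most 3σ, and σ_min(s*) converts this into a bound on each moment of order below s*
(`abs_moment_sub_le`).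

Now pair `μ - μs` with the monic polynomial q of degree 2p that vanishes on the support of `μ` and
at all nodes of `μs` but one, v_l. Only the amplitude at v_l survives. The moment and coefficient
bounds make this pairing small (`sum_abs_coeff_mul_factorial_le`), while Lagrange interpolation
supplies an l for which q(v_l) is large in terms of the separation
(`exists_le_abs_eval_mul_prod_abs_sub`). The separation hypothesis makes the two bounds incompatible
(`factorial_mul_sqrt_lt`). The moments up to order 2p are available because 2p < s*: otherwise n
nodes so far apart would not fit in [-d, d] (`two_mul_lt_of_separated`). -/

/-- Bessel's inequality for band-limited functions sampled at spacing at most `π`. -/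
theorem mul_sum_sq_norm_noise_le {h : ℝ} (hh : 0 < h) (hhπ : h ≤ Real.pi) (R : ℝ) (N : ℕ)
    {v : ℝ → ℂ} (hv : MemLp v 2) (hband : ∀ ω : ℝ, 1 < |ω| → v ω = 0) :
    h * ∑ t : Fin N, ‖noise v (samplePoint R h t)‖ ^ 2 ≤
      1 / (2 * Real.pi) * ∫ ω : ℝ, ‖v ω‖ ^ 2 := by
  have hπ := Real.pi_pos
  have h1 : 1 ≤ Real.pi / h := by rwa [le_div_iff₀ hh, one_mul]
  have hab : -(Real.pi / h) < Real.pi / h := by linarith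
  have hint : ∀ {E : Type} [NormedAddCommGroup E] [NormedSpace ℝ E] (g : ℝ → E),
      (∀ ω : ℝ, 1 < |ω| → g ω = 0) →
      ∫ ω in -(Real.pi / h)..(Real.pi / h), g ω = ∫ ω, g ω := by
    intro E _ _ g hg
    rw [intervalIntegral.integral_of_le hab.le, ← integral_Icc_eq_integral_Ioc]
    refine setIntegral_eq_integral_of_forall_compl_eq_zero fun ω hω => hg ω ?_
    by_contra hcon
    rw [not_lt, abs_le] at hcon
    exact hω ⟨by linarith [hcon.1], by linarith [hcon.2]⟩
  -- The phase absorbs the grid origin -R, so the sample values become, up to the factor h, Fourier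
  -- coefficients on [-π/h, π/h]. This interval contains the band because h ≤ π.
  set u : ℝ → ℂ := fun ω => Complex.exp (((-(ω * R) : ℝ) : ℂ) * Complex.I) * v ω with hu
  have hnorm : ∀ ω, ‖u ω‖ = ‖v ω‖ := fun ω => by
    rw [hu]
    simp only [norm_mul, Complex.norm_exp_ofReal_mul_I, one_mul]
  have huL : MemLp u 2 := by
    refine hv.of_le ?_ (Filter.Eventually.of_forall fun ω => (hnorm ω).le)
    exact (Continuous.aestronglyMeasurable (by fun_prop)).mul hv.1
  have key := hasSum_sq_fourierCoeffOn hab (huL.restrict _)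
  rw [hint (fun ω => ‖u ω‖ ^ 2) (fun ω hω => by simp [hnorm, hband ω hω])] at key
  have hcoef : ∀ t : Fin N, ‖fourierCoeffOn hab u (-((t : ℕ) : ℤ))‖ =
      h * ‖noise v (samplePoint R h t)‖ := by
    intro t
    rw [fourierCoeffOn_eq_integral, hint]
    · have e : ∀ ω : ℝ, fourier (-(-((t : ℕ) : ℤ)))
          (ω : AddCircle (Real.pi / h - -(Real.pi / h))) • u ω =
          v ω * Complex.exp (Complex.I * ω * samplePoint R h t) := by
        intro ω
        rw [fourier_coe_apply, hu, smul_eq_mul, ← mul_assoc, ← Complex.exp_add, mul_comm]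
        congr 2
        have hhC : (h : ℂ) ≠ 0 := by exact_mod_cast hh.ne'
        have hπC : (Real.pi : ℂ) ≠ 0 := by exact_mod_cast hπ.ne'
        simp only [samplePoint]
        push_cast
        field_simp
        ring
      simp_rw [e, noise]
      rw [norm_smul, norm_mul]
      have : ‖(1 / (2 * Real.pi) : ℂ)‖ = 1 / (2 * Real.pi) := by
        simp [abs_of_pos hπ]
      rw [this, ← mul_assoc, Real.norm_of_nonneg (by positivity)]
      congr 1
      field_simp
      ring
    · intro ω hω
      simp [hu, hband ω hω]
  have hle : ∑ t : Fin N, (h * ‖noise v (samplePoint R h t)‖) ^ 2 ≤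
      (Real.pi / h - -(Real.pi / h))⁻¹ • ∫ ω, ‖u ω‖ ^ 2 := by
    simp_rw [← hcoef]
    have hinj : Function.Injective (fun t : Fin N => -((t : ℕ) : ℤ)) := fun a b hab => by
      simpa [Fin.ext_iff] using hab
    have hmap := Finset.sum_map Finset.univ ⟨_, hinj⟩ (fun i => ‖fourierCoeffOn hab u i‖ ^ 2)
    exact hmap.symm.trans_le (sum_le_hasSum _ (fun _ _ => by positivity) key)
  simp_rw [hnorm, mul_pow] at hle
  rw [← Finset.mul_sum, smul_eq_mul] at hle
  refine le_of_mul_le_mul_left ?_ hh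
  calc _ = h ^ 2 * ∑ t : Fin N, ‖noise v (samplePoint R h t)‖ ^ 2 := by ring
    _ ≤ _ := hle
    _ = _ := by field_simp; ring

/-- Restriction of a spectrum to the frequency band `[-1, 1]`. -/
def bandCut (φ : ℝ → ℂ) : ℝ → ℂ := (Set.Icc (-1) 1).indicator φ

theorem bandCut_eq_zero (φ : ℝ → ℂ) (ω : ℝ) (hω : 1 < |ω|) : bandCut φ ω = 0 := by
  refine Set.indicator_of_notMem (fun hmem => ?_) _
  exact absurd (abs_le.mpr ⟨hmem.1, hmem.2⟩) (not_le.mpr hω)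

theorem memLp_bandCut {φ : ℝ → ℂ} (hφ : Continuous φ) : MemLp (bandCut φ) 2 := by
  rw [bandCut, memLp_indicator_iff_restrict measurableSet_Icc]
  obtain ⟨C, hC⟩ := isCompact_Icc.exists_bound_of_continuousOn hφ.continuousOn
  exact MemLp.of_bound hφ.aestronglyMeasurable C (ae_restrict_of_forall_mem measurableSet_Icc hC)

theorem noise_bandCut (φ : ℝ → ℂ) (x : ℝ) :
    noise (bandCut φ) x = (1 / (2 * Real.pi) : ℂ) *
      ∫ ω in (-1 : ℝ)..1, φ ω * Complex.exp (Complex.I * ω * x) := by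
  rw [noise, intervalIntegral.integral_of_le (by norm_num), ← integral_Icc_eq_integral_Ioc,
    ← integral_indicator measurableSet_Icc]
  congr 2
  ext ω
  rw [bandCut, Set.indicator_mul_left]

theorem integral_norm_sq_bandCut (φ : ℝ → ℂ) :
    ∫ ω, ‖bandCut φ ω‖ ^ 2 = ∫ ω in (-1 : ℝ)..1, ‖φ ω‖ ^ 2 := by
  rw [intervalIntegral.integral_of_le (by norm_num), ← integral_Icc_eq_integral_Ioc,
    ← integral_indicator measurableSet_Icc]
  congr 1
  ext ω
  by_cases hω : ω ∈ Set.Icc (-1 : ℝ) 1 <;> simp [bandCut, hω]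

theorem noise_bandCut_sub {φ ψ : ℝ → ℂ} (hφ : Continuous φ) (hψ : Continuous ψ) (x : ℝ) :
    noise (bandCut fun ω => φ ω - ψ ω) x = noise (bandCut φ) x - noise (bandCut ψ) x := by
  simp only [noise_bandCut, sub_mul]
  rw [intervalIntegral.integral_sub, mul_sub]
  · exact Continuous.intervalIntegrable (by fun_prop) _ _
  · exact Continuous.intervalIntegrable (by fun_prop) _ _

theorem noise_bandCut_sum {ι : Type*} (s : Finset ι) (c : ι → ℂ) {φ : ι → ℝ → ℂ}
    (hφ : ∀ i, Continuous (φ i)) (x : ℝ) :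
    noise (bandCut fun ω => ∑ i ∈ s, c i * φ i ω) x = ∑ i ∈ s, c i * noise (bandCut (φ i)) x := by
  simp only [noise_bandCut, Finset.sum_mul, mul_assoc]
  rw [intervalIntegral.integral_finsetSum, Finset.mul_sum]
  · refine Finset.sum_congr rfl fun i _ => ?_
    rw [intervalIntegral.integral_const_mul]
    ring
  · intro i _
    have := hφ i
    exact Continuous.intervalIntegrable (by fun_prop) _ _

theorem hasDerivAt_noise_bandCut {φ : ℝ → ℂ} (hφ : Continuous φ) (x : ℝ) :
    HasDerivAt (noise (bandCut φ)) (noise (bandCut fun ω => Complex.I * ω * φ ω) x) x := by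
  have : noise (bandCut φ) = fun x : ℝ => (1 / (2 * Real.pi) : ℂ) *
      ∫ ω in (-1 : ℝ)..1, φ ω * Complex.exp (Complex.I * ω * x) := funext (noise_bandCut φ)
  rw [this, noise_bandCut]
  refine HasDerivAt.const_mul _ ?_
  refine (intervalIntegral.hasDerivAt_integral_of_dominated_loc_of_deriv_le (𝕜 := ℝ)
    (F := fun (y : ℝ) (ω : ℝ) => φ ω * Complex.exp (Complex.I * ω * y))
    (F' := fun (y : ℝ) (ω : ℝ) => Complex.I * ω * φ ω * Complex.exp (Complex.I * ω * y))
    (s := Set.univ) (bound := fun ω => ‖Complex.I * ω * φ ω‖) Filter.univ_mem ?_ ?_ ?_ ?_ ?_ ?_).2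
  · exact Filter.Eventually.of_forall fun y =>
      Continuous.aestronglyMeasurable (by fun_prop)
  · exact Continuous.intervalIntegrable (by fun_prop) _ _
  · exact Continuous.aestronglyMeasurable (by fun_prop)
  · refine Filter.Eventually.of_forall fun ω _ y _ => ?_
    have : Complex.I * ω * y = ((ω * y : ℝ) : ℂ) * Complex.I := by push_cast; ring
    rw [norm_mul _ (Complex.exp _), this, Complex.norm_exp_ofReal_mul_I, mul_one]
  · exact Continuous.intervalIntegrable (by fun_prop) _ _
  · refine Filter.Eventually.of_forall fun ω _ y _ => ?_
    have h1 : HasDerivAt (fun y : ℝ => Complex.I * ω * (y : ℂ)) (Complex.I * ω) y := by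
      simpa using (Complex.ofRealCLM.hasDerivAt (x := y)).const_mul (Complex.I * ω)
    exact (h1.cexp.const_mul (φ ω)).congr_deriv (by ring)

theorem psf_eq_noise (x : ℝ) : (psf x : ℂ) = noise (bandCut fun _ => (Real.pi : ℂ)) x := by
  have hπC : (Real.pi : ℂ) ≠ 0 := by exact_mod_cast Real.pi_ne_zero
  rw [noise_bandCut, intervalIntegral.integral_const_mul]
  rcases eq_or_ne x 0 with rfl | hx
  · simp [psf]
    field_simp
    norm_num
  · have hxC : (x : ℂ) ≠ 0 := by exact_mod_cast hx
    have h1 := intervalIntegral.integral_comp_mul_right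
      (fun t : ℝ => Complex.exp (t * Complex.I)) hx (a := -1) (b := 1)
    have h2 : (fun ω : ℝ => Complex.exp (Complex.I * ω * x)) =
        fun ω : ℝ => Complex.exp (((ω * x : ℝ) : ℂ) * Complex.I) := by
      ext ω
      congr 1
      push_cast
      ring
    rw [h2, h1, neg_one_mul, one_mul, integral_exp_mul_I_eq_sinc, Complex.real_smul, psf]
    push_cast
    field_simp

/-- Each derivative multiplies the spectrum by iω, starting from the constant spectrum π of sinc. -/
theorem iteratedDeriv_psf_eq_noise (r : ℕ) (x : ℝ) :
    ((iteratedDeriv r psf x : ℝ) : ℂ) =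
      noise (bandCut fun ω => Real.pi * (Complex.I * ω) ^ r) x := by
  induction r generalizing x with
  | zero => simpa using psf_eq_noise x
  | succ r ih =>
    have hd := hasDerivAt_noise_bandCut
      (φ := fun ω : ℝ => Real.pi * (Complex.I * ω) ^ r) (by fun_prop) x
    rw [← funext ih] at hd
    have hre : DifferentiableAt ℝ (iteratedDeriv r psf) x :=
      (Complex.reCLM.hasFDerivAt.comp_hasDerivAt x hd).differentiableAt
    rw [iteratedDeriv_succ, hre.hasDerivAt.ofReal_comp.unique hd]
    congr 2
    ext ω
    ring

theorem image_eq_noise (μ : DiscreteMeasure) (x : ℝ) :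
    (image μ x : ℂ) = noise (bandCut fun ω : ℝ =>
      ∑ y ∈ μ.support, (μ y : ℂ) * (Real.pi * Complex.exp (-(Complex.I * ω * y)))) x := by
  rw [noise_bandCut_sum _ _ (fun y => by fun_prop), image]
  push_cast
  refine Finset.sum_congr rfl fun y _ => ?_
  rw [psf_eq_noise, noise_bandCut, noise_bandCut]
  congr 3
  ext ω
  rw [mul_assoc (Real.pi : ℂ), ← Complex.exp_add]
  congr 2
  push_cast
  ring

/-- The `r`-th moment of a discrete measure. -/
def moment (μ : DiscreteMeasure) (r : ℕ) : ℝ := ∑ y ∈ μ.support, μ y * y ^ r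

theorem sum_mul_eval_eq_sum_coeff_mul_moment (μ : DiscreteMeasure) (q : Polynomial ℝ) {m : ℕ}
    (hm : q.natDegree < m) :
    ∑ y ∈ μ.support, μ y * q.eval y = ∑ r ∈ Finset.range m, q.coeff r * moment μ r := by
  simp_rw [moment, Finset.mul_sum]
  rw [Finset.sum_comm]
  refine Finset.sum_congr rfl fun y _ => ?_
  rw [Polynomial.eval_eq_sum_range' hm, Finset.mul_sum]
  exact Finset.sum_congr rfl fun r _ => by ring

/-- Since n! r! ≤ (n + r)!, the exponential tail is dominated termwise by its first term times the
full series. -/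
theorem norm_exp_sub_sum_le (z : ℂ) (n : ℕ) :
    ‖Complex.exp z - ∑ r ∈ Finset.range n, z ^ r / (r.factorial : ℂ)‖ ≤
      ‖z‖ ^ n / n.factorial * Real.exp ‖z‖ := by
  refine (Complex.norm_exp_sub_sum_le_exp_norm_sub_sum z n).trans ?_
  have hs : HasSum (fun r : ℕ => ‖z‖ ^ r / (r.factorial : ℝ)) (Real.exp ‖z‖) := by
    rw [Real.exp_eq_exp_ℝ]
    exact NormedSpace.expSeries_div_hasSum_exp ‖z‖
  have h1 := (hasSum_nat_add_iff' n).mpr hs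
  refine hasSum_le (fun r => ?_) h1 (hs.mul_left (‖z‖ ^ n / n.factorial))
  rw [div_mul_div_comm, ← pow_add, add_comm n r]
  have : (n.factorial : ℝ) * r.factorial ≤ ((r + n).factorial : ℝ) := by
    rw [add_comm r n]
    exact_mod_cast Nat.factorial_mul_factorial_dvd_factorial_add n r |>.elim fun c hc => by
      rcases Nat.eq_zero_or_pos c with rfl | hc0
      · simp [Nat.factorial_ne_zero] at hc
      · rw [hc]; exact Nat.le_mul_of_pos_right _ hc0
  gcongr

/-- The truncation error of the multipole expansion of an image, in the sampled norm. -/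
theorem mul_sum_sq_image_sub_multipole_le {h : ℝ} (hh : 0 < h) (hhπ : h ≤ Real.pi) (R : ℝ) (N : ℕ)
    (μ : DiscreteMeasure) {d : ℝ} (hd : ∀ y ∈ μ.support, |y| ≤ d) (hd0 : 0 ≤ d) (s : ℕ) :
    h * ∑ t : Fin N, (image μ (samplePoint R h t) - ∑ r ∈ Finset.range s,
        (-1) ^ r * moment μ r / r.factorial * iteratedDeriv r psf (samplePoint R h t)) ^ 2 ≤
      Real.pi * (tvNorm μ * (d ^ s / s.factorial * Real.exp d)) ^ 2 / (2 * s + 1) := by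
  set φ : ℝ → ℂ := fun ω =>
    (∑ y ∈ μ.support, (μ y : ℂ) * (Real.pi * Complex.exp (-(Complex.I * ω * y)))) -
    ∑ r ∈ Finset.range s, (((-1) ^ r * moment μ r / r.factorial : ℝ) : ℂ) *
      (Real.pi * (Complex.I * ω) ^ r) with hφ
  have hφc : Continuous φ := by rw [hφ]; fun_prop
  have hexp : ∀ x, ((image μ x - ∑ r ∈ Finset.range s,
      (-1) ^ r * moment μ r / r.factorial * iteratedDeriv r psf x : ℝ) : ℂ) =
      noise (bandCut φ) x := by
    intro x
    rw [hφ, noise_bandCut_sub (by fun_prop) (by fun_prop), ← image_eq_noise,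
      noise_bandCut_sum _ _ (fun r => by fun_prop)]
    simp_rw [← iteratedDeriv_psf_eq_noise]
    push_cast
    rfl
  have hφ' : ∀ ω : ℝ, φ ω = ∑ y ∈ μ.support, (μ y : ℂ) * (Real.pi *
      (Complex.exp (-(Complex.I * ω * y)) -
        ∑ r ∈ Finset.range s, (-(Complex.I * ω * y)) ^ r / (r.factorial : ℂ))) := by
    intro ω
    simp only [hφ, moment, mul_sub, Finset.sum_sub_distrib]
    congr 1
    push_cast
    simp_rw [Finset.mul_sum, Finset.sum_div, Finset.sum_mul]
    rw [Finset.sum_comm]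
    refine Finset.sum_congr rfl fun y _ => Finset.sum_congr rfl fun r _ => ?_
    rw [neg_pow (Complex.I * ω * y), mul_pow _ (y : ℂ)]
    ring
  -- Keeping the power of ω matters: its integral 2 / (2s + 1) produces the √(2l+1) in the
  -- definition of s*.
  have hbound : ∀ ω ∈ Set.Icc (-1 : ℝ) 1, ‖φ ω‖ ^ 2 ≤
      (Real.pi * (tvNorm μ * (d ^ s / s.factorial * Real.exp d))) ^ 2 * ω ^ (2 * s) := by
    intro ω hω
    have hω1 : |ω| ≤ 1 := abs_le.mpr ⟨hω.1, hω.2⟩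
    have : ‖φ ω‖ ≤ Real.pi * (tvNorm μ * (d ^ s / s.factorial * Real.exp d)) * |ω| ^ s := by
      rw [hφ']
      refine (norm_sum_le _ _).trans ?_
      rw [tvNorm, Finset.sum_mul, Finset.mul_sum, Finset.sum_mul]
      refine Finset.sum_le_sum fun y hy => ?_
      have hz : ‖-(Complex.I * ω * y)‖ = |ω| * |y| := by simp
      have hT := norm_exp_sub_sum_le (-(Complex.I * ω * y)) s
      rw [hz, mul_pow] at hT
      have h2 : |ω| * |y| ≤ d := by nlinarith [hd y hy, abs_nonneg ω, abs_nonneg y]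
      have h3 : |ω| ^ s * |y| ^ s / s.factorial * Real.exp (|ω| * |y|) ≤
          |ω| ^ s * d ^ s / s.factorial * Real.exp d := by
        have := hd y hy
        gcongr
      rw [norm_mul, norm_mul, Complex.norm_real, Complex.norm_real, Real.norm_eq_abs,
        Real.norm_eq_abs, abs_of_pos Real.pi_pos]
      calc _ ≤ |μ y| * (Real.pi * (|ω| ^ s * d ^ s / s.factorial * Real.exp d)) := by
            have := Real.pi_pos
            gcongr
            exact hT.trans h3
        _ = _ := by ring
    calc ‖φ ω‖ ^ 2 ≤ (Real.pi * (tvNorm μ * (d ^ s / s.factorial * Real.exp d)) * |ω| ^ s) ^ 2 := by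
          gcongr
      _ = _ := by rw [mul_pow, ← pow_mul, mul_comm s 2, pow_mul |ω|, sq_abs, ← pow_mul]
  have hB := mul_sum_sq_norm_noise_le hh hhπ R N (memLp_bandCut hφc) (bandCut_eq_zero φ)
  simp_rw [← hexp, Complex.norm_real, Real.norm_eq_abs, sq_abs] at hB
  refine hB.trans ?_
  rw [integral_norm_sq_bandCut]
  have hI : ∫ ω in (-1 : ℝ)..1, ‖φ ω‖ ^ 2 ≤ ∫ ω in (-1 : ℝ)..1,
      (Real.pi * (tvNorm μ * (d ^ s / s.factorial * Real.exp d))) ^ 2 * ω ^ (2 * s) :=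
    intervalIntegral.integral_mono_on (by norm_num)
      (Continuous.intervalIntegrable (by fun_prop) _ _)
      (Continuous.intervalIntegrable (by fun_prop) _ _) hbound
  rw [intervalIntegral.integral_const_mul, integral_pow, one_pow,
    Odd.neg_one_pow ⟨s, rfl⟩] at hI
  have hπ := Real.pi_pos
  calc _ ≤ 1 / (2 * Real.pi) * _ := mul_le_mul_of_nonneg_left hI (by positivity)
    _ = _ := by push_cast; field_simp; ring

theorem mul_sum_sq_psf_le {h : ℝ} (hh : 0 < h) (hhπ : h ≤ Real.pi) (R : ℝ) (N : ℕ) :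
    h * ∑ t : Fin N, psf (samplePoint R h t) ^ 2 ≤ Real.pi := by
  have hB := mul_sum_sq_norm_noise_le hh hhπ R N
    (memLp_bandCut (φ := fun _ => (Real.pi : ℂ)) continuous_const) (bandCut_eq_zero _)
  simp_rw [← psf_eq_noise, Complex.norm_real, Real.norm_eq_abs, sq_abs] at hB
  refine hB.trans (le_of_eq ?_)
  have hπ := Real.pi_pos
  rw [integral_norm_sq_bandCut]
  simp only [Complex.norm_real, Real.norm_eq_abs, sq_abs, intervalIntegral.integral_const,
    smul_eq_mul]
  field_simp
  norm_num

end Deconvolution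

end

/-! ### Monic polynomials at separated nodes. -/

noncomputable section

namespace Deconvolution

open Finset

theorem prod_range_erase_abs_sub (l k : ℕ) :
    ∏ i ∈ (range (l + 1 + k)).erase l, |(l : ℝ) - i| = l.factorial * k.factorial := by
  set g : ℕ → ℝ := fun i => if i = l then 1 else |(l : ℝ) - i| with hg
  have h1 : ∏ i ∈ (range (l + 1 + k)).erase l, |(l : ℝ) - i| =
      ∏ i ∈ (range (l + 1 + k)).erase l, g i :=
    prod_congr rfl fun i hi => by simp [hg, ne_of_mem_erase hi]
  rw [h1, prod_erase _ (by simp [hg]), prod_range_add, prod_range_succ]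
  have h2 : ∏ i ∈ range l, g i = l.factorial := by
    rw [← Nat.descFactorial_self, Nat.descFactorial_eq_prod_range, Nat.cast_prod]
    refine prod_congr rfl fun i hi => ?_
    have hi := mem_range.mp hi
    have : (i : ℝ) < l := by exact_mod_cast hi
    simp only [hg, if_neg hi.ne]
    rw [abs_of_pos (by linarith), Nat.cast_sub hi.le]
  have h3 : ∏ i ∈ range k, g (l + 1 + i) = k.factorial := by
    rw [← prod_range_add_one_eq_factorial, Nat.cast_prod]
    refine prod_congr rfl fun i _ => ?_
    simp only [hg, if_neg (show l + 1 + i ≠ l by omega)]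
    push_cast
    rw [abs_sub_comm, show (l : ℝ) + 1 + i - l = i + 1 by ring, abs_of_nonneg (by positivity)]
  rw [h2, h3]
  simp [hg]

/-- Equally spaced nodes with gap D are the extremal case, and there the product is explicit. -/
theorem factorial_mul_pow_le_prod_abs_sub {p : ℕ} {v : ℕ → ℝ} {D : ℝ} (hD : 0 ≤ D)
    (hv : ∀ i j, i < j → j ≤ p → ((j : ℝ) - i) * D ≤ v j - v i) {l : ℕ} (hl : l ≤ p) :
    (l.factorial * (p - l).factorial : ℝ) * D ^ p ≤
      ∏ i ∈ (range (p + 1)).erase l, |v l - v i| := by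
  have hp : p + 1 = l + 1 + (p - l) := by omega
  have hcard : ((range (p + 1)).erase l).card = p := by
    rw [card_erase_of_mem (mem_range.mpr (by omega)), card_range, Nat.add_sub_cancel]
  have h1 := prod_range_erase_abs_sub l (p - l)
  rw [← hp] at h1
  rw [← h1]
  nth_rewrite 2 [← hcard]
  rw [← prod_const, ← prod_mul_distrib]
  refine prod_le_prod (fun i _ => by positivity) fun i hi => ?_
  have hne := ne_of_mem_erase hi
  have hip : i ≤ p := Nat.lt_succ_iff.mp (mem_range.mp (mem_of_mem_erase hi))
  rcases lt_or_gt_of_ne hne with h | h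
  · have : (i : ℝ) < l := by exact_mod_cast h
    rw [abs_of_pos (by linarith)]
    exact (hv i l h hl).trans (le_abs_self _)
  · have : (l : ℝ) < i := by exact_mod_cast h
    rw [abs_sub_comm, abs_of_pos (by linarith), abs_sub_comm]
    exact (hv l i h hip).trans (le_abs_self _)

/-- A monic polynomial of degree `p` cannot be small, relative to the nodal weights, at all of
`p + 1` separated nodes. -/
theorem exists_le_abs_eval_mul_prod_abs_sub {p : ℕ} {v : ℕ → ℝ} {D : ℝ} (hD : 0 < D)
    (hv : ∀ i j, i < j → j ≤ p → ((j : ℝ) - i) * D ≤ v j - v i)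
    {q : Polynomial ℝ} (hq : q.Monic) (hdeg : q.natDegree = p) :
    ∃ l ≤ p, (p.factorial : ℝ) ^ 4 / (2 * p).factorial * D ^ (2 * p) ≤
      |q.eval (v l)| * ∏ i ∈ (range (p + 1)).erase l, |v l - v i| := by
  by_contra! hcon
  have hinj : Set.InjOn v (range (p + 1)) := by
    intro i hi j hj hij
    simp only [coe_range, Set.mem_Iio] at hi hj
    rcases lt_trichotomy i j with h | h | h
    · have h1 := hv i j h (by omega)
      have : (i : ℝ) < j := by exact_mod_cast h
      nlinarith
    · exact h
    · have h1 := hv j i h (by omega)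
      have : (j : ℝ) < i := by exact_mod_cast h
      nlinarith
  -- The leading coefficient, here 1, is the sum of q(v_l) / ∏ (v_l - v_i) over the nodes.
  have hsum := Lagrange.leadingCoeff_eq_sum hinj (P := q)
    (by rw [card_range, Polynomial.degree_eq_natDegree hq.ne_zero, hdeg]; norm_cast)
  rw [hq.leadingCoeff] at hsum
  -- The upper bounds sum to exactly 1, because ∑ C(p,l)² = C(2p,p); this fixes the constant p!⁴ /
  -- (2p)!.
  have hterm : ∀ l ∈ range (p + 1), |q.eval (v l) / ∏ i ∈ (range (p + 1)).erase l, (v l - v i)| <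
      (p.factorial : ℝ) ^ 2 / (2 * p).factorial * (p.choose l : ℝ) ^ 2 := by
    intro l hl
    have hlp : l ≤ p := Nat.lt_succ_iff.mp (mem_range.mp hl)
    have hP := factorial_mul_pow_le_prod_abs_sub hD.le hv hlp
    have hP0 : 0 < (l.factorial * (p - l).factorial : ℝ) * D ^ p := by positivity
    have hPpos := hP0.trans_le hP
    rw [abs_div, abs_prod, div_lt_iff₀ hPpos]
    refine lt_of_mul_lt_mul_right ((hcon l hlp).trans_le ?_) hPpos.le
    have hch : (p.choose l : ℝ) * (l.factorial * (p - l).factorial) = p.factorial := by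
      rw [← mul_assoc]
      exact_mod_cast Nat.choose_mul_factorial_mul_factorial hlp
    calc (p.factorial : ℝ) ^ 4 / (2 * p).factorial * D ^ (2 * p)
        = (p.factorial : ℝ) ^ 2 / (2 * p).factorial * (p.choose l : ℝ) ^ 2 *
          ((l.factorial * (p - l).factorial : ℝ) * D ^ p) ^ 2 := by
          rw [show (p.factorial : ℝ) ^ 4 = p.factorial ^ 2 * p.factorial ^ 2 by ring]
          nth_rewrite 2 [← hch]
          ring
      _ ≤ (p.factorial : ℝ) ^ 2 / (2 * p).factorial * (p.choose l : ℝ) ^ 2 *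
          (∏ i ∈ (range (p + 1)).erase l, |v l - v i|) ^ 2 := by gcongr
      _ = _ := by ring
  have hlt := sum_lt_sum_of_nonempty (by simp) hterm
  have h1 := (abs_sum_le_sum_abs (fun l => q.eval (v l) /
    ∏ i ∈ (range (p + 1)).erase l, (v l - v i)) (range (p + 1))).trans_lt hlt
  rw [← hsum, abs_one, ← mul_sum] at h1
  have h2 : ∑ l ∈ range (p + 1), (p.choose l : ℝ) ^ 2 = (2 * p).choose p := by
    exact_mod_cast Nat.sum_range_choose_sq p
  have h3 : ((2 * p).choose p : ℝ) * p.factorial * p.factorial = (2 * p).factorial := by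
    have := Nat.choose_mul_factorial_mul_factorial (show p ≤ 2 * p by omega)
    rw [show 2 * p - p = p by omega] at this
    exact_mod_cast this
  rw [h2, div_mul_eq_mul_div, lt_div_iff₀ (by positivity)] at h1
  nlinarith

/-- Induction with (p+1) C(2p+2,p+1) = 2(2p+1) C(2p,p) and (2p+1)(2p+3) ≤ 4(p+1)². -/
theorem centralBinom_sq_mul_le (p : ℕ) : p.centralBinom ^ 2 * (2 * p + 1) ≤ 16 ^ p := by
  induction p with
  | zero => simp
  | succ p ih =>
    have h := Nat.succ_mul_centralBinom_succ p
    have hpos : 0 < (p + 1) ^ 2 := by positivity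
    refine Nat.le_of_mul_le_mul_left ?_ hpos
    calc (p + 1) ^ 2 * ((p + 1).centralBinom ^ 2 * (2 * (p + 1) + 1))
        = ((p + 1) * (p + 1).centralBinom) ^ 2 * (2 * p + 3) := by ring
      _ = (p.centralBinom ^ 2 * (2 * p + 1)) * (4 * ((2 * p + 1) * (2 * p + 3))) := by rw [h]; ring
      _ ≤ 16 ^ p * (4 * (4 * (p + 1) ^ 2)) :=
          Nat.mul_le_mul ih (Nat.mul_le_mul_left 4 (by nlinarith))
      _ = _ := by ring

/-- The final numerical comparison. After division by p!⁴ the left side is at most C(2p,p)² (2p+1) ≤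
4^(2p), so any base above 4 would do in place of 4.7. -/
theorem factorial_mul_sqrt_lt {p : ℕ} (hp : 1 ≤ p) :
    ((2 * p).factorial : ℝ) * √(2 * (2 * p : ℕ) + 1) <
      4.7 ^ (2 * p) * ((p.factorial : ℝ) ^ 4 / (2 * p).factorial) := by
  have h1 : (p.centralBinom : ℝ) ^ 2 * (2 * p + 1) ≤ 16 ^ p := by
    exact_mod_cast centralBinom_sq_mul_le p
  have h2 : (p.centralBinom : ℝ) * p.factorial ^ 2 = (2 * p).factorial := by
    have := Nat.choose_mul_factorial_mul_factorial (show p ≤ 2 * p by omega)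
    rw [show 2 * p - p = p by omega] at this
    rw [Nat.centralBinom, sq, ← mul_assoc]
    exact_mod_cast this
  have h3 : √(2 * (2 * p : ℕ) + 1) ≤ 2 * (p : ℝ) + 1 := by
    refine Real.sqrt_le_iff.mpr ⟨by positivity, ?_⟩
    push_cast
    nlinarith [sq_nonneg (p : ℝ)]
  have h4 : (16 : ℝ) ^ p < 4.7 ^ (2 * p) := by
    rw [pow_mul]
    exact pow_lt_pow_left₀ (by norm_num) (by norm_num) (by omega)
  rw [mul_div_assoc', lt_div_iff₀ (by positivity)]
  calc ((2 * p).factorial : ℝ) * √(2 * (2 * p : ℕ) + 1) * (2 * p).factorial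
      ≤ (2 * p).factorial * (2 * (p : ℝ) + 1) * (2 * p).factorial := by gcongr
    _ = (p.factorial : ℝ) ^ 4 * ((p.centralBinom : ℝ) ^ 2 * (2 * p + 1)) := by rw [← h2]; ring
    _ ≤ (p.factorial : ℝ) ^ 4 * 16 ^ p := by gcongr
    _ < (p.factorial : ℝ) ^ 4 * 4.7 ^ (2 * p) := by gcongr
    _ = _ := by ring

/-- Coefficient bound for a monic polynomial all of whose roots lie in `[-d, d]`. -/
theorem abs_coeff_prod_X_sub_C_le (s : Multiset ℝ) {d : ℝ} (hs : ∀ y ∈ s, |y| ≤ d) (r : ℕ) :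
    |((s.map fun y => Polynomial.X - Polynomial.C y).prod).coeff r| ≤
      ((Polynomial.X + Polynomial.C d) ^ s.card).coeff r := by
  induction s using Multiset.induction_on generalizing r with
  | empty => simp [Polynomial.coeff_one]; split_ifs <;> simp
  | cons a s ih =>
    have ih' := ih fun y hy => hs y (Multiset.mem_cons_of_mem hy)
    have ha := hs a (Multiset.mem_cons_self a s)
    rw [Multiset.map_cons, Multiset.prod_cons, Multiset.card_cons, pow_succ', sub_mul, add_mul,
      Polynomial.coeff_sub, Polynomial.coeff_add, Polynomial.coeff_C_mul, Polynomial.coeff_C_mul]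
    refine (abs_sub _ _).trans (add_le_add ?_ ?_)
    · rcases r with _ | r
      · simp
      · simpa only [Polynomial.coeff_X_mul] using ih' r
    · rw [abs_mul]
      have := ih' r
      have := (abs_nonneg a).trans ha
      gcongr

theorem exists_ordered_nodes (S : Finset ℝ) {p : ℕ} (hS : S.card = p + 1) :
    ∃ v : ℕ → ℝ, (range (p + 1)).image v = S ∧
      ∀ i j, i < j → j ≤ p → ((j : ℝ) - i) * (S : Set ℝ).infsep ≤ v j - v i := by
  set e := S.orderEmbOfFin hS with he
  -- The value 0 past index p is a filler; the gap bound is a telescoping sum of consecutive gaps.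
  refine ⟨fun i => if hi : i < p + 1 then e ⟨i, hi⟩ else 0, ?_, ?_⟩
  · ext y
    have hr : y ∈ Set.range e ↔ y ∈ S := by rw [he, range_orderEmbOfFin]; simp
    rw [← hr, mem_image]
    constructor
    · rintro ⟨i, hi, rfl⟩
      exact ⟨⟨i, mem_range.mp hi⟩, by simp [mem_range.mp hi]⟩
    · rintro ⟨i, rfl⟩
      exact ⟨i, mem_range.mpr i.2, dif_pos i.2⟩
  · intro i j hij
    induction j, hij using Nat.le_induction with
    | base =>
      intro hj
      have h1 : i < p + 1 := by omega
      have h2 : i + 1 < p + 1 := by omega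
      have hlt : e ⟨i, h1⟩ < e ⟨i + 1, h2⟩ := e.strictMono (by simp)
      simp only [h1, h2, dif_pos, Nat.succ_eq_add_one]
      have := Set.infsep_le_dist_of_mem
        (S.orderEmbOfFin_mem hS ⟨i + 1, h2⟩) (S.orderEmbOfFin_mem hS ⟨i, h1⟩) hlt.ne'
      rw [Real.dist_eq, abs_of_pos (by linarith)] at this
      push_cast
      linarith
    | succ j hj ih =>
      intro hjp
      have h1 : j < p + 1 := by omega
      have h2 : j + 1 < p + 1 := by omega
      have h0 := ih (by omega)
      have hlt : e ⟨j, h1⟩ < e ⟨j + 1, h2⟩ := e.strictMono (by simp)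
      simp only [h1, h2, dif_pos] at h0 ⊢
      have := Set.infsep_le_dist_of_mem
        (S.orderEmbOfFin_mem hS ⟨j + 1, h2⟩) (S.orderEmbOfFin_mem hS ⟨j, h1⟩) hlt.ne'
      rw [Real.dist_eq, abs_of_pos (by linarith)] at this
      push_cast
      linarith

end Deconvolution

end

/-! ### Moment bounds from the smallest singular value, and the size of s*. -/

noncomputable section

namespace Deconvolution

open Finset

/-- In an orthonormal eigenbasis of T*T, ‖Tx‖² is a combination of squared coordinates weighted by
the squared singular values, the least of which has index s - 1. -/
theorem singularValues_mul_norm_le {E F : Type*} [NormedAddCommGroup E] [InnerProductSpace ℝ E]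
    [FiniteDimensional ℝ E] [NormedAddCommGroup F] [InnerProductSpace ℝ F] [FiniteDimensional ℝ F]
    (T : E →ₗ[ℝ] F) {s : ℕ} (hs : Module.finrank ℝ E = s) (x : E) :
    T.singularValues (s - 1) ^ 2 * ‖x‖ ^ 2 ≤ ‖T x‖ ^ 2 := by
  have hT := T.isSymmetric_adjoint_comp_self
  set b := hT.eigenvectorBasis hs with hb
  have h1 : ‖T x‖ ^ 2 = ∑ i, hT.eigenvalues hs i * (b.repr x i) ^ 2 := by
    rw [← real_inner_self_eq_norm_sq, ← LinearMap.adjoint_inner_left, ← LinearMap.comp_apply,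
      ← b.repr.inner_map_map, PiLp.inner_apply]
    refine sum_congr rfl fun i _ => ?_
    rw [hb, hT.eigenvectorBasis_apply_self_apply hs]
    simp
    ring
  have h2 : ‖x‖ ^ 2 = ∑ i, (b.repr x i) ^ 2 := by
    rw [← b.repr.norm_map, EuclideanSpace.norm_sq_eq]
    simp
  rw [h1, h2, mul_sum]
  refine sum_le_sum fun i _ => ?_
  rw [← T.sq_singularValues_fin hs i]
  have := T.singularValues_antitone (Nat.le_sub_one_of_lt i.2)
  have := T.singularValues_nonneg (s - 1)
  gcongr

theorem sigmaMin_sq_mul_sum_sq_le {h : ℝ} (hh : 0 < h) (R : ℝ) (N s : ℕ) (c : ℕ → ℝ) :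
    sigmaMin R h N s ^ 2 * ∑ r ∈ range s, c r ^ 2 ≤
      h * ∑ t : Fin N, (∑ r ∈ range s, √(2 * r + 1) * c r *
        iteratedDeriv r psf (samplePoint R h t)) ^ 2 := by
  have key := singularValues_mul_norm_le
    (Matrix.toEuclideanLin (√h • multipoleMatrix R h N s)) (finrank_euclideanSpace_fin (n := s))
    (WithLp.toLp 2 fun r : Fin s => c r)
  rw [EuclideanSpace.norm_sq_eq, EuclideanSpace.norm_sq_eq] at key
  rw [sigmaMin, ← Fin.sum_univ_eq_sum_range (fun r => c r ^ 2)]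
  convert key using 1
  · simp
  · rw [mul_sum]
    refine sum_congr rfl fun t _ => ?_
    rw [← Fin.sum_univ_eq_sum_range (fun r => √(2 * (r : ℝ) + 1) * c r *
      iteratedDeriv r psf (samplePoint R h t))]
    simp only [Matrix.toLpLin_apply, Matrix.smul_mulVec, multipoleMatrix, PiLp.smul_apply,
      WithLp.toLp_smul, smul_eq_mul, Matrix.mulVec, dotProduct, Matrix.of_apply,
      Real.norm_eq_abs, sq_abs, mul_pow, Real.sq_sqrt hh.le]
    congr 2
    exact sum_congr rfl fun r _ => by ring

/-- Test on the first coordinate vector: the column of samples of f itself has scaled norm at most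
√π. -/
theorem sigmaMin_le_sqrt_pi {h : ℝ} (hh : 0 < h) (hhπ : h ≤ Real.pi) (R : ℝ) (N : ℕ) {s : ℕ}
    (hs : 1 ≤ s) : sigmaMin R h N s ≤ √Real.pi := by
  refine Real.le_sqrt_of_sq_le ?_
  have key := sigmaMin_sq_mul_sum_sq_le hh R N s (fun r => if r = 0 then 1 else 0)
  have h0 : 0 < s := hs
  refine le_trans (le_of_eq ?_) (key.trans ((le_of_eq ?_).trans (mul_sum_sq_psf_le hh hhπ R N)))
  · simp [h0]
  · simp [h0]

/-- The infimum is attained because d^l / l! tends to 0, which makes the defining set nonempty. -/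
theorem sStar_spec {d σ M : ℝ} (hd : 0 ≤ d) (hσ : 0 < σ) (hM : 0 < M) :
    1 ≤ sStar d σ M ∧
      d ^ sStar d σ M / (((sStar d σ M).factorial : ℝ) * √(2 * (sStar d σ M : ℝ) + 1)) ≤
        σ / (2 * Real.exp d * √Real.pi * M) := by
  refine Nat.sInf_mem (s := {l : ℕ | 1 ≤ l ∧ d ^ l / ((l.factorial : ℝ) * √(2 * (l : ℝ) + 1)) ≤
      σ / (2 * Real.exp d * √Real.pi * M)}) ?_
  have hπ := Real.pi_pos
  have hpos : 0 < σ / (2 * Real.exp d * √Real.pi * M) := by positivity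
  obtain ⟨l, hl, hl1⟩ := (((FloorSemiring.tendsto_pow_div_factorial_atTop d).eventually_le_const
    hpos).and (Filter.eventually_ge_atTop 1)).exists
  refine ⟨l, hl1, le_trans ?_ hl⟩
  have : 1 ≤ √(2 * (l : ℝ) + 1) := Real.one_le_sqrt.mpr (by linarith [Nat.cast_nonneg (α := ℝ) l])
  gcongr
  exact le_mul_of_one_le_right (by positivity) this

theorem image_sub (μ ν : DiscreteMeasure) (x : ℝ) :
    image (μ - ν) x = image μ x - image ν x :=
  Finsupp.sum_sub_index (h := fun y a => a * psf (x - y)) fun _ _ _ => sub_mul _ _ _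

theorem sum_sub_mul (μ ν : DiscreteMeasure) (g : ℝ → ℝ) :
    ∑ y ∈ (μ - ν).support, (μ - ν) y * g y =
      ∑ y ∈ μ.support, μ y * g y - ∑ y ∈ ν.support, ν y * g y :=
  Finsupp.sum_sub_index (h := fun y a => a * g y) fun _ _ _ => sub_mul _ _ _

theorem tvNorm_eq_sum {μ : DiscreteMeasure} {S : Finset ℝ} (hS : μ.support ⊆ S) :
    tvNorm μ = ∑ y ∈ S, |μ y| :=
  sum_subset hS fun y _ hy => by simp [Finsupp.notMem_support_iff.mp hy]

theorem tvNorm_sub_le (μ ν : DiscreteMeasure) : tvNorm (μ - ν) ≤ tvNorm μ + tvNorm ν := by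
  classical
  rw [tvNorm_eq_sum (Finsupp.support_sub (f := μ) (g := ν)),
    tvNorm_eq_sum (subset_union_left (s₁ := μ.support) (s₂ := ν.support)),
    tvNorm_eq_sum (subset_union_right (s₁ := μ.support) (s₂ := ν.support)), ← sum_add_distrib]
  exact sum_le_sum fun y _ => abs_sub (μ y) (ν y)

theorem minAmplitude_le {μ : DiscreteMeasure} {y : ℝ} (hy : y ∈ μ.support) :
    minAmplitude μ ≤ |μ y| :=
  ciInf_le (Set.finite_range _).bddBelow (⟨y, hy⟩ : μ.support)

theorem minAmplitude_pos {μ : DiscreteMeasure} (hμ : μ.support.Nonempty) : 0 < minAmplitude μ := by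
  have : Nonempty μ.support := hμ.to_subtype
  obtain ⟨y, hy⟩ := exists_eq_ciInf_of_finite (f := fun y : μ.support => |μ y|)
  rw [minAmplitude, ← hy]
  exact abs_pos.mpr (Finsupp.mem_support_iff.mp y.2)

theorem card_mul_minAmplitude_le (μ : DiscreteMeasure) :
    μ.support.card * minAmplitude μ ≤ tvNorm μ := by
  rw [tvNorm, ← nsmul_eq_mul]
  exact card_nsmul_le_sum _ _ _ fun y hy => minAmplitude_le hy

/-- The moments of the difference of two measures with nearby sampled images are small. -/
theorem abs_moment_sub_le {d σ M R h : ℝ} {N : ℕ} (hd : 0 ≤ d) (hσ : 0 < σ) (hMpos : 0 < M)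
    (hh : 0 < h) (hhπ : h ≤ Real.pi) {μs μ : DiscreteMeasure}
    (hsupp : ∀ y ∈ μs.support, y ∈ Set.Icc (-d) d) (hM : tvNorm μs ≤ M)
    {w : ℝ → ℂ} (hw : IsNoiseSpectrum w σ)
    (hmin : 0 < sigmaMin R h N (sStar d σ M))
    (hμ : IsAdmissible d σ M R h (measurement μs w R h N) μ) {r : ℕ} (hr : r < sStar d σ M) :
    |moment (μ - μs) r| ≤
      3 * σ / sigmaMin R h N (sStar d σ M) * (r.factorial * √(2 * r + 1)) := by
  classical
  obtain ⟨-, hspec⟩ := sStar_spec hd hσ hMpos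
  set s := sStar d σ M with hs
  have hπ := Real.pi_pos
  have hρ : ∀ y ∈ (μ - μs).support, |y| ≤ d := by
    intro y hy
    rcases mem_union.mp (Finsupp.support_sub hy) with h' | h'
    · exact abs_le.mpr (hμ.supported y h')
    · exact abs_le.mpr (hsupp y h')
  have htv : tvNorm (μ - μs) ≤ 2 * M := by
    linarith [tvNorm_sub_le μ μs, hμ.tvNorm_le]
  have htv0 : 0 ≤ tvNorm (μ - μs) := sum_nonneg fun _ _ => abs_nonneg _
  have hres := mul_sum_sq_image_sub_multipole_le hh hhπ R N (μ - μs) hρ hd s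
  set P : Fin N → ℝ := fun t => ∑ r ∈ range s, (-1) ^ r * moment (μ - μs) r / r.factorial *
    iteratedDeriv r psf (samplePoint R h t) with hP
  have hres' : h * ∑ t : Fin N, (image (μ - μs) (samplePoint R h t) - P t) ^ 2 ≤ σ ^ 2 := by
    refine hres.trans ?_
    have hsq : 0 < √(2 * (s : ℝ) + 1) := by positivity
    have h1 : √Real.pi * (2 * M * (d ^ s / s.factorial * Real.exp d)) / √(2 * s + 1) ≤ σ := by
      rw [le_div_iff₀ (by positivity)] at hspec
      refine le_trans (le_of_eq ?_) hspec
      field_simp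
    calc Real.pi * (tvNorm (μ - μs) * (d ^ s / s.factorial * Real.exp d)) ^ 2 / (2 * s + 1)
        ≤ Real.pi * (2 * M * (d ^ s / s.factorial * Real.exp d)) ^ 2 / (2 * s + 1) := by gcongr
      _ = (√Real.pi * (2 * M * (d ^ s / s.factorial * Real.exp d)) / √(2 * s + 1)) ^ 2 := by
          rw [div_pow, mul_pow √Real.pi, Real.sq_sqrt hπ.le, Real.sq_sqrt (by positivity)]
      _ ≤ σ ^ 2 := by gcongr
  have hnoise : h * ∑ t : Fin N, ‖noise w (samplePoint R h t)‖ ^ 2 ≤ σ ^ 2 := by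
    refine (mul_sum_sq_norm_noise_le hh hhπ R N hw.memLp hw.bandLimited).trans ?_
    have h1 := (Real.sqrt_le_left (by positivity)).mp hw.level
    rw [mul_pow, Real.sq_sqrt (by positivity)] at h1
    rw [one_div, inv_mul_le_iff₀ (by positivity)]
    exact h1
  have hclose : h * ∑ t : Fin N, ‖(image μ (samplePoint R h t) : ℂ) -
      measurement μs w R h N t‖ ^ 2 ≤ σ ^ 2 := by
    have h1 := hμ.close
    rw [← Real.sqrt_mul hh.le, Real.sqrt_le_left hσ.le] at h1
    exact h1
  have hPle : h * ∑ t : Fin N, P t ^ 2 ≤ (3 * σ) ^ 2 := by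
    -- The multipole sum splits into data misfit, noise and truncation error; (a + b + c)² ≤ 3(a² +
    -- b² + c²) then yields 9σ² in total.
    have hpt : ∀ t : Fin N, P t ^ 2 ≤ 3 * (‖(image μ (samplePoint R h t) : ℂ) -
        measurement μs w R h N t‖ ^ 2 + ‖noise w (samplePoint R h t)‖ ^ 2 +
        (image (μ - μs) (samplePoint R h t) - P t) ^ 2) := by
      intro t
      have e : (P t : ℂ) = ((image μ (samplePoint R h t) : ℂ) - measurement μs w R h N t) +
          noise w (samplePoint R h t) -
          ((image (μ - μs) (samplePoint R h t) - P t : ℝ) : ℂ) := by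
        rw [image_sub, measurement]
        push_cast
        ring
      have h1 : |P t| ≤ ‖(image μ (samplePoint R h t) : ℂ) - measurement μs w R h N t‖ +
          ‖noise w (samplePoint R h t)‖ + |image (μ - μs) (samplePoint R h t) - P t| := by
        rw [← Real.norm_eq_abs, ← Complex.norm_real, e]
        refine (norm_sub_le _ _).trans ?_
        rw [Complex.norm_real, Real.norm_eq_abs]
        gcongr
        exact norm_add_le _ _
      rw [← sq_abs (P t), ← sq_abs (image (μ - μs) (samplePoint R h t) - P t)]
      generalize ‖(image μ (samplePoint R h t) : ℂ) - measurement μs w R h N t‖ = a at h1 ⊢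
      generalize ‖noise w (samplePoint R h t)‖ = b at h1 ⊢
      generalize |image (μ - μs) (samplePoint R h t) - P t| = c at h1 ⊢
      have h2 := pow_le_pow_left₀ (abs_nonneg _) h1 2
      nlinarith [sq_nonneg (a - b), sq_nonneg (b - c), sq_nonneg (a - c)]
    have hsum := sum_le_sum fun t (_ : t ∈ univ) => hpt t
    rw [← mul_sum, sum_add_distrib, sum_add_distrib] at hsum
    have := mul_le_mul_of_nonneg_left hsum hh.le
    linarith
  -- Coordinates of the multipole sum with respect to the normalized columns √(2r+1) f^(r).
  have key := sigmaMin_sq_mul_sum_sq_le hh R N s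
    (fun r => (-1) ^ r * moment (μ - μs) r / (r.factorial * √(2 * r + 1)))
  have hPeq : ∀ t, ∑ r ∈ range s, √(2 * r + 1) *
      ((-1) ^ r * moment (μ - μs) r / (r.factorial * √(2 * r + 1))) *
      iteratedDeriv r psf (samplePoint R h t) = P t := by
    intro t
    refine sum_congr rfl fun r _ => ?_
    have : √(2 * (r : ℝ) + 1) ≠ 0 := by positivity
    field_simp
  simp_rw [hPeq] at key
  have hsingle := single_le_sum (f := fun r : ℕ =>
    ((-1) ^ r * moment (μ - μs) r / (r.factorial * √(2 * (r : ℝ) + 1))) ^ 2)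
    (fun _ _ => sq_nonneg _) (mem_range.mpr hr)
  have hfin : (sigmaMin R h N s *
      |(-1) ^ r * moment (μ - μs) r / (r.factorial * √(2 * (r : ℝ) + 1))|) ^ 2 ≤ (3 * σ) ^ 2 := by
    rw [mul_pow, sq_abs]
    exact (mul_le_mul_of_nonneg_left hsingle (sq_nonneg _)).trans (key.trans hPle)
  have hfin' := le_of_sq_le_sq hfin (by positivity)
  rw [abs_div, abs_mul, abs_pow, abs_neg, abs_one, one_pow, one_mul,
    abs_of_pos (show 0 < (r.factorial : ℝ) * √(2 * r + 1) by positivity)] at hfin'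
  rw [div_mul_eq_mul_div, le_div_iff₀ hmin, mul_comm]
  rwa [mul_div_assoc', div_le_iff₀ (by positivity)] at hfin'

/-- The coefficients are dominated by those of (X + d)^m, which sum to (1 + d)^m, and the weight r!
√(2r+1) increases with r. -/
theorem sum_abs_coeff_mul_factorial_le (S : Multiset ℝ) {d : ℝ} (hS : ∀ y ∈ S, |y| ≤ d) {m : ℕ}
    (hm : S.card = m) :
    ∑ r ∈ range (m + 1), |((S.map fun y => Polynomial.X - Polynomial.C y).prod).coeff r| *
      (r.factorial * √(2 * r + 1)) ≤ m.factorial * √(2 * m + 1) * (1 + d) ^ m := by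
  have hev : ∑ r ∈ range (m + 1), ((Polynomial.X + Polynomial.C d) ^ m).coeff r = (1 + d) ^ m := by
    have h1 : ((Polynomial.X + Polynomial.C d) ^ m).natDegree < m + 1 := by
      rw [Polynomial.natDegree_pow, Polynomial.natDegree_X_add_C]; omega
    have h2 := Polynomial.eval_eq_sum_range' h1 1
    simpa using h2.symm
  rw [← hev, mul_sum]
  refine sum_le_sum fun r hr => ?_
  have hrm : r ≤ m := Nat.lt_succ_iff.mp (mem_range.mp hr)
  have hc := abs_coeff_prod_X_sub_C_le S hS r
  rw [hm] at hc
  rw [mul_comm]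
  have hf : (r.factorial : ℝ) ≤ m.factorial := by exact_mod_cast Nat.factorial_le hrm
  have hrm' : (r : ℝ) ≤ m := by exact_mod_cast hrm
  gcongr

/-- Under the separation condition the multipole order `s*` is at least `2n - 1`. -/
theorem two_mul_lt_of_separated {p s : ℕ} (hp : 1 ≤ p) {d σ M D m S : ℝ}
    (hd : 0 < d) (hσ : 0 < σ) (hm : 0 < m) (hM : (p + 1) * m ≤ M)
    (hS : 0 < S) (hSπ : S ≤ √Real.pi) (hD : 0 ≤ D) (hDd : p * D ≤ 2 * d)
    (hspec : d ^ s / ((s.factorial : ℝ) * √(2 * (s : ℝ) + 1)) ≤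
        σ / (2 * Real.exp d * √Real.pi * M))
    (hsep : (4.7 * (1 + d)) ^ (2 * p) * (3 / S * (σ / m)) ≤ D ^ (2 * p)) :
    2 * p < s := by
  by_contra! hs
  have hπ := Real.pi_pos
  have hMpos : 0 < M := lt_of_lt_of_le (by positivity) hM
  have hsq : 0 < √(2 * (s : ℝ) + 1) := by positivity
  have hp0 : (0 : ℝ) < p := by exact_mod_cast hp
  -- The bound defining s*, with e^d ≥ 1, M ≥ (p+1)m and S ≤ √π, forces a minimal noise-to-signal
  -- ratio.
  have hτ : 6 * (p + 1) * (d ^ s / ((s.factorial : ℝ) * √(2 * (s : ℝ) + 1))) ≤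
      3 / S * (σ / m) := by
    calc 6 * (p + 1) * (d ^ s / ((s.factorial : ℝ) * √(2 * (s : ℝ) + 1)))
        ≤ 6 * (p + 1) * (σ / (2 * Real.exp d * √Real.pi * M)) := by gcongr
      _ ≤ 6 * (p + 1) * (σ / (2 * 1 * √Real.pi * ((p + 1) * m))) := by
          have := Real.one_le_exp hd.le
          gcongr
      _ = 3 / √Real.pi * (σ / m) := by field_simp; norm_num
      _ ≤ 3 / S * (σ / m) := by gcongr
  -- Combine this with the separation and the packing bound pD ≤ 2d. Bounding s! √(2s+1) for s ≤ 2p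
  -- and cancelling d^(2p) leaves a false inequality between 4.7^(2p) and 4^(2p).
  have h1 : (4.7 * (1 + d)) ^ (2 * p) *
      (6 * (p + 1) * (d ^ s / ((s.factorial : ℝ) * √(2 * (s : ℝ) + 1)))) * p ^ (2 * p) ≤
      (2 * d) ^ (2 * p) := by
    calc _ ≤ D ^ (2 * p) * p ^ (2 * p) := by
          gcongr
          exact (mul_le_mul_of_nonneg_left hτ (by positivity)).trans hsep
      _ = (p * D) ^ (2 * p) := by rw [mul_pow, mul_comm]
      _ ≤ _ := by gcongr
  have h2 : d ^ (2 * p) ≤ (1 + d) ^ (2 * p) * d ^ s := by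
    calc d ^ (2 * p) = d ^ (2 * p - s) * d ^ s := by rw [← pow_add]; congr 1; omega
      _ ≤ (1 + d) ^ (2 * p - s) * d ^ s := by gcongr; linarith
      _ ≤ (1 + d) ^ (2 * p) * d ^ s := by
          gcongr
          · linarith
          · omega
  have h3 : (s.factorial : ℝ) * √(2 * (s : ℝ) + 1) ≤ (2 * p) ^ (2 * p) * (2 * p + 1) := by
    have hf : (s.factorial : ℝ) ≤ (2 * p) ^ (2 * p) := by
      exact_mod_cast (Nat.factorial_le hs).trans (Nat.factorial_le_pow _)
    have hr : √(2 * (s : ℝ) + 1) ≤ 2 * p + 1 := by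
      refine Real.sqrt_le_iff.mpr ⟨by positivity, ?_⟩
      have : (s : ℝ) ≤ 2 * p := by exact_mod_cast hs
      nlinarith
    gcongr
  have h4 : (4.7 : ℝ) ^ (2 * p) * (6 * (p + 1)) * p ^ (2 * p) * d ^ (2 * p) ≤
      2 ^ (2 * p) * ((2 * p) ^ (2 * p) * (2 * p + 1)) * d ^ (2 * p) := by
    calc _ ≤ (4.7 : ℝ) ^ (2 * p) * (6 * (p + 1)) * p ^ (2 * p) * ((1 + d) ^ (2 * p) * d ^ s) := by
          gcongr
      _ = (4.7 * (1 + d)) ^ (2 * p) *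
          (6 * (p + 1) * (d ^ s / ((s.factorial : ℝ) * √(2 * (s : ℝ) + 1)))) * p ^ (2 * p) *
          ((s.factorial : ℝ) * √(2 * (s : ℝ) + 1)) := by
          rw [mul_pow 4.7]
          field_simp
      _ ≤ (2 * d) ^ (2 * p) * ((2 * p) ^ (2 * p) * (2 * p + 1)) := by gcongr
      _ = _ := by rw [mul_pow 2 d]; ring
  have h5 := le_of_mul_le_mul_right h4 (by positivity)
  have h6 : (4 : ℝ) ^ (2 * p) < 4.7 ^ (2 * p) :=
    pow_lt_pow_left₀ (by norm_num) (by norm_num) (by omega)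
  have h7 : (2 : ℝ) ^ (2 * p) * ((2 * p) ^ (2 * p) * (2 * p + 1)) <
      4.7 ^ (2 * p) * (6 * (p + 1)) * p ^ (2 * p) := by
    calc (2 : ℝ) ^ (2 * p) * ((2 * p) ^ (2 * p) * (2 * p + 1))
        = 4 ^ (2 * p) * (2 * p + 1) * p ^ (2 * p) := by
          rw [mul_pow 2 (p : ℝ), show (4 : ℝ) = 2 * 2 by norm_num, mul_pow 2 2]; ring
      _ < 4.7 ^ (2 * p) * (6 * (p + 1)) * p ^ (2 * p) := by
          gcongr
          linarith
  linarith

end Deconvolution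

end

/-! ### The annihilating polynomial and the contradiction. -/

theorem theorem2p2
    (n : ℕ) (hn : 2 ≤ n)
    (d σ M : ℝ) (hσ : 0 < σ)
    -- sampling on `[-R, R]` at the `N` points `-R, -R + h, …, R` with spacing `h ≤ π`
    (R h : ℝ) (N : ℕ) (hR : 0 < R) (hh : 0 < h) (hhπ : h ≤ Real.pi)
    (hN : ((N : ℝ) - 1) * h = 2 * R)
    -- the source measure
    (μs : Deconvolution.DiscreteMeasure)
    (hcard : μs.support.card = n)
    (hsupp : ∀ y ∈ μs.support, y ∈ Set.Icc (-d) d)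
    (hM : Deconvolution.tvNorm μs ≤ M)
    -- the noise
    (w : ℝ → ℂ) (hw : Deconvolution.IsNoiseSpectrum w σ)
    -- the separation condition, whose right side is finite only if `σ_min(s*) > 0`
    (hmin : 0 < Deconvolution.sigmaMin R h N (Deconvolution.sStar d σ M))
    (hsep : 4.7 * (1 + d) *
        (3 / Deconvolution.sigmaMin R h N (Deconvolution.sStar d σ M) *
          (σ / Deconvolution.minAmplitude μs)) ^ (1 / (2 * (n : ℝ) - 2)) ≤
      (μs.support : Set ℝ).infsep) :
    ∀ μ : Deconvolution.DiscreteMeasure, μ.support.card < n →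
      ¬ Deconvolution.IsAdmissible d σ M R h
        (Deconvolution.measurement μs w R h N) μ := by
  open Deconvolution Finset in
  intro μ hμcard hμ
  obtain ⟨p, rfl⟩ : ∃ p, n = p + 1 := ⟨n - 1, by omega⟩
  have hp : 1 ≤ p := by omega
  obtain ⟨v, hvS, hgap⟩ := exists_ordered_nodes μs.support hcard
  have hvmem : ∀ i ≤ p, v i ∈ μs.support := fun i hi => by
    rw [← hvS]
    exact mem_image_of_mem _ (mem_range.mpr (by omega))
  have hm : 0 < minAmplitude μs := minAmplitude_pos ⟨_, hvmem 0 (by omega)⟩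
  have hMm : ((p : ℝ) + 1) * minAmplitude μs ≤ M := by
    have h1 := card_mul_minAmplitude_le μs
    rw [hcard] at h1
    push_cast at h1
    exact h1.trans hM
  have hMpos : 0 < M := lt_of_lt_of_le (by positivity) hMm
  have hd0 : 0 ≤ d := by
    have := hsupp _ (hvmem 0 (by omega))
    linarith [this.1, this.2]
  set D := (μs.support : Set ℝ).infsep with hDdef
  set S := sigmaMin R h N (sStar d σ M) with hSdef
  set τ := 3 / S * (σ / minAmplitude μs) with hτ
  have hτpos : 0 < τ := by positivity
  have hDpos : 0 < D := lt_of_lt_of_le (by positivity) hsep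
  have hpD : p * D ≤ 2 * d := by
    have h1 := hgap 0 p hp le_rfl
    have h2 := hsupp _ (hvmem 0 (by omega))
    have h3 := hsupp _ (hvmem p le_rfl)
    push_cast at h1
    linarith [h2.1, h3.2]
  have hp0 : (0 : ℝ) < p := by exact_mod_cast hp
  -- At least two distinct nodes lie in [-d, d].
  have hd : 0 < d := by nlinarith [mul_pos hp0 hDpos]
  have hsep' : (4.7 * (1 + d)) ^ (2 * p) * τ ≤ D ^ (2 * p) := by
    have h1 := pow_le_pow_left₀ (by positivity) hsep (2 * p)
    have h2 : (τ ^ (1 / (2 * ((p + 1 : ℕ) : ℝ) - 2))) ^ (2 * p) = τ := by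
      rw [← Real.rpow_natCast, ← Real.rpow_mul hτpos.le]
      have : 1 / (2 * ((p + 1 : ℕ) : ℝ) - 2) * ((2 * p : ℕ) : ℝ) = 1 := by
        push_cast
        rw [show 2 * ((p : ℝ) + 1) - 2 = 2 * p by ring]
        field_simp
      rw [this, Real.rpow_one]
    rwa [mul_pow, h2] at h1
  obtain ⟨hs1, hspec⟩ := sStar_spec hd0 hσ hMpos
  have hs : 2 * p < sStar d σ M :=
    two_mul_lt_of_separated hp hd hσ hm hMm hmin (sigmaMin_le_sqrt_pi hh hhπ R N hs1) hDpos.le hpD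
      hspec hsep'
  -- a polynomial vanishing on both supports except at one point of `μs`
  set A : Multiset ℝ := μ.support.val + Multiset.replicate (p - μ.support.card) 0 with hA
  -- Padding with the root 0, which lies in [-d, d], makes the degree exactly p, as the Lagrange
  -- argument requires.
  have hAcard : A.card = p := by simp [hA]; omega
  have hAd : ∀ y ∈ A, |y| ≤ d := by
    intro y hy
    rcases Multiset.mem_add.mp hy with h' | h'
    · exact abs_le.mpr (hμ.supported y h')
    · rw [Multiset.eq_of_mem_replicate h', abs_zero]
      exact hd0
  obtain ⟨l, hl, hbig⟩ := exists_le_abs_eval_mul_prod_abs_sub hDpos hgap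
    (q := (A.map fun y => Polynomial.X - Polynomial.C y).prod)
    (Polynomial.monic_multisetProd_X_sub_C A)
    (by rw [Polynomial.natDegree_multiset_prod_X_sub_C_eq_card, hAcard])
  set B : Multiset ℝ := A + ((range (p + 1)).erase l).val.map v with hB
  have hBcard : B.card = 2 * p := by
    rw [hB, Multiset.card_add, hAcard, Multiset.card_map, card_val,
      card_erase_of_mem (mem_range.mpr (by omega)), card_range]
    omega
  have hBd : ∀ y ∈ B, |y| ≤ d := by
    intro y hy
    rcases Multiset.mem_add.mp hy with h' | h'
    · exact hAd y h'
    · obtain ⟨i, hi, rfl⟩ := Multiset.mem_map.mp h'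
      have hi' := mem_range.mp (mem_of_mem_erase (mem_val.mp hi))
      exact abs_le.mpr (hsupp _ (hvmem i (by omega)))
  set q := (B.map fun y => Polynomial.X - Polynomial.C y).prod with hq
  have hqdeg : q.natDegree < 2 * p + 1 := by
    rw [hq, Polynomial.natDegree_multiset_prod_X_sub_C_eq_card, hBcard]
    omega
  have hqzero : ∀ y ∈ B, q.eval y = 0 := fun y hy => by
    rw [hq, Polynomial.eval_multiset_prod, Multiset.map_map]
    exact Multiset.prod_eq_zero (Multiset.mem_map.mpr ⟨y, hy, by simp⟩)
  have hqeval : |q.eval (v l)| = |(A.map fun y => Polynomial.X - Polynomial.C y).prod.eval (v l)| *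
      ∏ i ∈ (range (p + 1)).erase l, |v l - v i| := by
    rw [hq, hB, Multiset.map_add, Multiset.prod_add, Polynomial.eval_mul, abs_mul, ← abs_prod]
    congr 2
    rw [Multiset.map_map, Polynomial.eval_multiset_prod, Multiset.map_map]
    simp [Finset.prod]
  rw [← hqeval] at hbig
  -- If v_l also lies in the support of `μ`, both sides vanish, so the supports need not be
  -- disjoint.
  have hpair : ∑ y ∈ (μ - μs).support, (μ - μs) y * q.eval y = -(μs (v l) * q.eval (v l)) := by
    rw [sum_sub_mul, sum_eq_zero (s := μ.support), zero_sub,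
      sum_eq_single_of_mem (v l) (hvmem l hl)]
    · intro y hy hne
      rw [← hvS] at hy
      obtain ⟨i, hi, rfl⟩ := mem_image.mp hy
      rw [hqzero, mul_zero]
      refine Multiset.mem_add.mpr (Or.inr (Multiset.mem_map.mpr ⟨i, ?_, rfl⟩))
      exact mem_val.mpr (mem_erase.mpr ⟨fun h' => hne (by rw [h']), hi⟩)
    · intro y hy
      rw [hqzero, mul_zero]
      exact Multiset.mem_add.mpr (Or.inl (Multiset.mem_add.mpr (Or.inl hy)))
  rw [sum_mul_eval_eq_sum_coeff_mul_moment _ q hqdeg] at hpair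
  have hupper : |μs (v l)| * |q.eval (v l)| ≤
      3 * σ / S * ((2 * p).factorial * √(2 * (2 * p : ℕ) + 1) * (1 + d) ^ (2 * p)) := by
    rw [← abs_mul, ← abs_neg, ← hpair]
    refine (abs_sum_le_sum_abs _ _).trans ?_
    refine le_trans ?_ (mul_le_mul_of_nonneg_left (sum_abs_coeff_mul_factorial_le B hBd hBcard)
      (show 0 ≤ 3 * σ / S by positivity))
    rw [mul_sum]
    refine sum_le_sum fun r hr => ?_
    have hr' := mem_range.mp hr
    have := abs_moment_sub_le hd0 hσ hMpos hh hhπ hsupp hM hw hmin hμ (r := r) (by omega)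
    rw [abs_mul, mul_left_comm]
    gcongr
  have hlower : minAmplitude μs * ((p.factorial : ℝ) ^ 4 / (2 * p).factorial *
      ((4.7 * (1 + d)) ^ (2 * p) * τ)) ≤ |μs (v l)| * |q.eval (v l)| := by
    have h1 := minAmplitude_le (hvmem l hl)
    refine mul_le_mul h1 (le_trans ?_ hbig) (by positivity) (abs_nonneg _)
    gcongr
  have hlt : 3 * σ / S * ((2 * p).factorial * √(2 * (2 * p : ℕ) + 1) * (1 + d) ^ (2 * p)) <
      minAmplitude μs * ((p.factorial : ℝ) ^ 4 / (2 * p).factorial *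
        ((4.7 * (1 + d)) ^ (2 * p) * τ)) := by
    have h1 := factorial_mul_sqrt_lt hp
    calc _ < 3 * σ / S * (4.7 ^ (2 * p) * ((p.factorial : ℝ) ^ 4 / (2 * p).factorial) *
          (1 + d) ^ (2 * p)) := by gcongr
      _ = _ := by
        rw [hτ, mul_pow]
        field_simp
  exact absurd (hlower.trans hupper) (not_le.mpr hlt)
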